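/- Consider a Markov decision process with finite state space $\mathcal X$, finite action space $\mathcal A$ and unknown time-invariant transition probabilities $P(x,a,y)$. Let $U\subset\mathcal X$ (forbidden set) and $E\subset\mathcal X$ (target set) be disjoint, let $H=\mathcal X\setminus(E\cup U)$, let $r(x,a)$ be a reward, and let $\bar x\in H$ be a fixed initial state. For a policy $\pi:\mathcal X\to\Delta(\mathcal A)$ let $S^P_\pi(x)=\mathbb P^{x,P}_\pi[\tau_U<\tau_E]$, where $\tau_B$ is the first hitting time of $B$. Assume that for every policy $\pi$ there is a deterministic $\tau_{max}<\infty$ with $\mathbb P^{x,P}_\pi[\tau_{E\cup U}\le\tau_{max}]=1$ for all $x$. Let $p,w\in(0,1)$, and let $K$ be the number of episodes. For $k=1,\dots,K$ let $N_k(x,a)$ and $N_k(x,a,y)$ be the numbers of visits to $(x,a)$ and of transitions $(x,a,y)$ observed before episode $k$, and put $\hat P_k(x,a,y)=\frac{N_k(x,a,y)}{N_k(x,a)\vee1}$, $\hat\kappa_k(x,a)=\sum_{y\in U}\hat P_k(x,a,y)$, $\hat\epsilon_k(x,a)=\sum_{y\in\mathcal X}\epsilon_k(x,a,y)$, where $$\epsilon_k(x,a,y)=\sqrt{\frac{4\hat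 P_k(x,a,y)(1-\hat P_k(x,a,y))\log\frac{2|\mathcal X||\mathcal A|K}{w}}{N_k(x,a)\vee1}}+\frac{14\log\frac{2|\mathcal X||\mathcal A|K}{w}}{3((N_k(x,a)-1)\vee1)}.$$ The extended LP of episode $k$ is to maximize $\sum_{(x,a,y)\in H\times\mathcal A\times\mathcal X}\beta(x,a,y)(r(x,a)+\hat\epsilon_k(x,a))$ over $\beta\ge0$ on $H\times\mathcal A\times\mathcal X$ subject to $$\delta_y(\bar x)+\sum_{(x,a)\in H\times\mathcal A}\beta(x,a,y)-\sum_{(a,z)\in\mathcal A\times\mathcal X}\beta(y,a,z)=0\qquad(y\in H),$$ $$(\hat P_k-\epsilon_k)(x,a,y)\sum_{z}\beta(x,a,z)\le\beta(x,a,y)\le(\hat P_k+\epsilon_k)(x,a,y)\sum_{z}\beta(x,a,z)\qquad((x,a,y)\in H\times\mathcal A\times\mathcal X),$$ $$\sum_{(x,a,z)\in H\times\mathcal A\times\mathcal X}\beta(x,a,z)(\hat\kappa_k(x,a)+3\hat\epsilon_k(x,a))\le p.$$ The $p$-safe RL algorithm proceeds in $K$ episodes. If the extended LP of episode $k$ is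 feasible, it takes an optimal solution $\beta$ and sets $$\tilde\pi^{\bar x}_k(a|x)=\frac{\sum_z\beta(x,a,z)}{\sum_{a',z}\beta(x,a',z)}$$ at all $x\in H$ where the denominator is non-zero ($\tilde\pi_k^{\bar x}(\cdot|x)$ is arbitrary at the other states); if the LP is infeasible, it sets $\tilde\pi_k^{\bar x}$ to a fixed baseline policy $\pi^S$. Then it starts at $X_0=\bar x$, follows $\tilde\pi_k^{\bar x}$ for the time steps $t=0,\dots,T$ or until $E\cup U$ is reached, and updates the counters. Then, with probability at least $1-2w$, the following holds for all $k\in\{1,\dots,K\}$: if the extended LP of episode $k$ is feasible, then the policy $\tilde\pi_k^{\bar x}$ extracted from it is $p$-safe at $\bar x$, i.e. $S^P_{\tilde\pi_k^{\bar x}}(\bar x)\le p$. -/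

import Mathlib

open MeasureTheory ProbabilityTheory

/-- A finite Markov decision process with transition probabilities `P`, a forbidden set `U`, a
target set `E` disjoint from it, and a reward `r`. -/
structure SafeMDP (X A : Type*) where
  /-- `P x a y` is the probability of moving from `x` to `y` under the action `a`. -/
  P : X → A → PMF X
  /-- the forbidden states -/
  U : Finset X
  /-- the target states -/
  E : Finset X
  disjoint : Disjoint U E
  /-- the reward -/
  r : X → A → ℝ

/-- A (stationary, randomized) policy. -/
abbrev Policy (X A : Type*) := X → PMF A

namespace SafeMDP

variable {X A : Type*} [Fintype X] [DecidableEq X] [Fintype A] [DecidableEq A]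

/-- The taboo set: all states that are neither forbidden nor target states. -/
def H (M : SafeMDP X A) : Finset X := Finset.univ \ (M.E ∪ M.U)

section Trajectories

variable [MeasurableSpace X] [DiscreteMeasurableSpace X]
  [MeasurableSpace A] [DiscreteMeasurableSpace A]

/-- The law of the next state-action pair when the current pair is `s`. -/
noncomputable def stepLaw (M : SafeMDP X A) (π : Policy X A) (s : X × A) : PMF (X × A) :=
  (M.P s.1 s.2).bind fun y => (π y).map fun b => (y, b)

/-- The one-step transition kernel of the chain `(X_t, A_t)` under the policy `π`. -/
noncomputable def stepKernel (M : SafeMDP X A) (π : Policy X A) : Kernel (X × A) (X × A) :=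
  Kernel.ofFunOfCountable fun s => (M.stepLaw π s).toMeasure

instance (M : SafeMDP X A) (π : Policy X A) : IsMarkovKernel (M.stepKernel π) :=
  ⟨fun s => PMF.toMeasure.isProbabilityMeasure (M.stepLaw π s)⟩

/-- The probability measure on the space `(X × A)^ℕ` of all trajectories
`(X_0, A_0, X_1, A_1, …)` under the policy `π`, started at `X_0 = x`. -/
noncomputable def trajLaw (M : SafeMDP X A) (π : Policy X A) (x : X) : Measure (ℕ → X × A) :=
  Kernel.trajMeasure (X := fun _ => X × A) ((π x).map fun a => (x, a)).toMeasure
    fun n => (M.stepKernel π).comap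
      (fun h : (Finset.Iic n → X × A) => h ⟨n, Finset.mem_Iic.2 le_rfl⟩) (measurable_pi_apply _)

/-- The first time `t ≥ 0` at which the state `X_t` lies in `S` (`⊤` if there is none). -/
noncomputable def hitTime (S : Finset X) : (ℕ → X × A) → WithTop ℕ :=
  hittingAfter (fun t ω => (ω t).1) (S : Set X) 0

/-- The safety function: the probability, from `x` and under the policy `π`, that the forbidden set
is hit before the target set. -/
noncomputable def safety (M : SafeMDP X A) (π : Policy X A) (x : X) : ℝ :=
  (M.trajLaw π x).real {ω | hitTime M.U ω < hitTime M.E ω}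

/-- The state `x` is `p`-safe with respect to the policy `π`. -/
def IsPSafe (M : SafeMDP X A) (p : ℝ) (π : Policy X A) (x : X) : Prop := M.safety π x ≤ p

/-- Under every policy, the stopping time `τ`, the hitting time of `E ∪ U`, is almost surely bounded
by a deterministic constant. -/
def BoundedStopping (M : SafeMDP X A) : Prop :=
  ∀ π : Policy X A, ∃ τmax : ℕ, ∀ x : X,
    ∀ᵐ ω ∂(M.trajLaw π x), hitTime (M.E ∪ M.U) ω ≤ (τmax : WithTop ℕ)

end Trajectories

end SafeMDP

/-- What is recorded in one episode: the list of its transitions `(X_t, A_t, X_{t+1})`. -/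
abbrev Episode (X A : Type*) := List (X × A × X)

/-- The episodes observed so far, in chronological order. -/
abbrev History (X A : Type*) := List (Episode X A)

namespace History

variable {X A : Type*} [Fintype X] [DecidableEq X] [Fintype A] [DecidableEq A]

/-- `N(x,a)`: the number of visits to `(x,a)` in the observed episodes. -/
def visits (h : History X A) (x : X) (a : A) : ℕ :=
  h.flatten.countP fun s => s.1 = x ∧ s.2.1 = a

/-- `N(x,a,y)`: the number of observed transitions from `x` to `y` under the action `a`. -/
def transitions (h : History X A) (x : X) (a : A) (y : X) : ℕ :=
  h.flatten.count (x, a, y)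

/-- The estimated transition probabilities `N(x,a,y) / (N(x,a) ∨ 1)`. -/
noncomputable def Phat (h : History X A) (x : X) (a : A) (y : X) : ℝ :=
  (h.transitions x a y : ℝ) / max (h.visits x a : ℝ) 1

/-- The estimated one-step probability of entering the forbidden set. -/
noncomputable def kappaHat (M : SafeMDP X A) (h : History X A) (x : X) (a : A) : ℝ :=
  ∑ y ∈ M.U, h.Phat x a y

/-- The confidence radius `ε(x,a,y)` for `K` episodes and the confidence parameter `w`. -/
noncomputable def eps (K : ℕ) (w : ℝ) (h : History X A) (x : X) (a : A) (y : X) : ℝ :=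
  Real.sqrt (4 * h.Phat x a y * (1 - h.Phat x a y)
      * Real.log (2 * Fintype.card X * Fintype.card A * K / w) / max (h.visits x a : ℝ) 1)
    + 14 * Real.log (2 * Fintype.card X * Fintype.card A * K / w)
      / (3 * max ((h.visits x a : ℝ) - 1) 1)

/-- `ε̂(x,a)`, the sum of `ε(x,a,y)` over all states `y`. -/
noncomputable def epsHat (K : ℕ) (w : ℝ) (h : History X A) (x : X) (a : A) : ℝ :=
  ∑ y, h.eps K w x a y

end History

namespace SafeMDP

variable {X A : Type*} [Fintype X] [DecidableEq X] [Fintype A] [DecidableEq A]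

/-- Feasibility of `β` for the extended linear program formed from the history `h`: flow balance for
the initial state `x₀`, transition probabilities within `ε` of the estimates, and the safety
constraint with the pessimistic costs `κ̂ + 3 ε̂`. -/
structure IsFeasible (M : SafeMDP X A) (K : ℕ) (w p : ℝ) (x₀ : X) (h : History X A)
    (β : X → A → X → ℝ) : Prop where
  nonneg : ∀ x ∈ M.H, ∀ a y, 0 ≤ β x a y
  flow : ∀ y ∈ M.H,
    (if y = x₀ then 1 else 0) + ∑ x ∈ M.H, ∑ a, β x a y - ∑ a, ∑ z, β y a z = 0
  upper : ∀ x ∈ M.H, ∀ a y,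
    β x a y - (h.Phat x a y + h.eps K w x a y) * ∑ z, β x a z ≤ 0
  lower : ∀ x ∈ M.H, ∀ a y,
    -β x a y + (h.Phat x a y - h.eps K w x a y) * ∑ z, β x a z ≤ 0
  safe : ∑ x ∈ M.H, ∑ a, ∑ z, β x a z * (h.kappaHat M x a + 3 * h.epsHat K w x a) ≤ p

/-- The objective of the extended linear program. -/
noncomputable def objective (M : SafeMDP X A) (K : ℕ) (w : ℝ) (h : History X A)
    (β : X → A → X → ℝ) : ℝ :=
  ∑ x ∈ M.H, ∑ a, ∑ y, β x a y * (M.r x a + h.epsHat K w x a)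

/-- `β` is an optimal solution of the extended linear program. -/
def IsOptimal (M : SafeMDP X A) (K : ℕ) (w p : ℝ) (x₀ : X) (h : History X A)
    (β : X → A → X → ℝ) : Prop :=
  M.IsFeasible K w p x₀ h β ∧
    ∀ β', M.IsFeasible K w p x₀ h β' → M.objective K w h β' ≤ M.objective K w h β

/-- The extended linear program formed from the history `h` is feasible. -/
def LPFeasible (M : SafeMDP X A) (K : ℕ) (w p : ℝ) (x₀ : X) (h : History X A) : Prop :=
  ∃ β, M.IsFeasible K w p x₀ h β

/-- `π` is extracted from `β` by normalization. At the states where the normalizing constant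
vanishes the formula says nothing and `π` is arbitrary. -/
def IsExtracted (M : SafeMDP X A) (β : X → A → X → ℝ) (π : Policy X A) : Prop :=
  ∀ x ∈ M.H, (∑ a', ∑ z, β x a' z) ≠ 0 →
    ∀ a, (π x a).toReal = (∑ z, β x a z) / ∑ a', ∑ z, β x a' z

/-- `pol` is a policy selection rule of the algorithm: after the history `h` it uses a policy
extracted from some optimal solution of the extended linear program if this program is feasible, and
the baseline policy `πS` otherwise. -/
def IsAlgorithmRule (M : SafeMDP X A) (K : ℕ) (w p : ℝ) (x₀ : X) (πS : Policy X A)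
    (pol : History X A → Policy X A) : Prop :=
  ∀ h, (M.LPFeasible K w p x₀ h → ∃ β, M.IsOptimal K w p x₀ h β ∧ M.IsExtracted β (pol h)) ∧
    (¬ M.LPFeasible K w p x₀ h → pol h = πS)

/-- The law of the transitions of one episode that starts at `x` and follows the policy `π` until a
state of `E ∪ U` is reached, or until `n` steps have been made. -/
noncomputable def episodeLaw (M : SafeMDP X A) (π : Policy X A) : ℕ → X → PMF (Episode X A)
  | 0, _ => PMF.pure []
  | n + 1, x =>
    if x ∈ M.H then
      (π x).bind fun a => (M.P x a).bind fun y =>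
        (episodeLaw M π n y).map fun e => (x, a, y) :: e
    else PMF.pure []

/-- The joint law of the first `k` episodes of the algorithm: each episode starts at `x₀`, runs the
loop `t = 0, …, T`, and uses the policy that the rule `pol` selects from the earlier episodes. -/
noncomputable def algorithmLaw (M : SafeMDP X A) (pol : History X A → Policy X A) (T : ℕ) (x₀ : X) :
    ℕ → PMF (History X A)
  | 0 => PMF.pure []
  | k + 1 => (algorithmLaw M pol T x₀ k).bind fun h =>
      (M.episodeLaw (pol h) (T + 1) x₀).map fun e => h ++ [e]

end SafeMDP

set_option linter.unusedSectionVars false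

namespace SafeMDP

variable {X A : Type*} [Fintype X] [DecidableEq X] [Fintype A] [DecidableEq A]

/-! The proof has a deterministic half and a probabilistic half, joined by the one-sided accuracy `P
- P̂ ≤ 2ε` on `H`.

If the estimates are accurate, a feasible `β` certifies safety. Let `V` be the probability of
entering `U` within `n` steps before leaving `H` otherwise. It is nondecreasing in `n`, so one
Bellman step gives an inequality for `V`. Weighted with `β` and summed over `H`, its internal flow
terms cancel by flow balance, which leaves `V x₀` below the safety cost. The cost `κ̂ + 3ε̂` pays
for `2ε` of estimation error and `ε` of slack in the LP (`IsFeasible.step_le`,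
`IsFeasible.isPSafe`). Letting `n` grow bounds the safety function (`safety_le`).

Accuracy follows from an exponential supermartingale for each triple `(x,a,y)`, indexed by the
visits to `(x,a)`. Its mean is at most one however the policies depend on the past, and Markov's
inequality at level `exp (2L)`, with `L` the logarithm in `ε`, gives a Bernstein bound for each
deterministic number `n` of visits. The actual number of visits is random, but bounded stopping
makes the possible transitions from `H` acyclic: a state occurs at most once per episode, so only `n
< K` matters and a union bound suffices (`le_toOuterMeasure_isAccurate`). -/

theorem mem_H_iff (M : SafeMDP X A) {x : X} : x ∈ M.H ↔ x ∉ M.E ∧ x ∉ M.U := by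
  simp [H, not_or]

theorem sum_toReal_eq_one {B : Type*} [Fintype B] (q : PMF B) : ∑ b, (q b).toReal = 1 := by
  rw [← ENNReal.toReal_sum fun b _ => q.apply_ne_top b, ← tsum_fintype (L := .unconditional B), q.tsum_coe,
    ENNReal.toReal_one]

theorem stepLaw_apply (M : SafeMDP X A) (π : Policy X A) (s t : X × A) :
    M.stepLaw π s t = M.P s.1 s.2 t.1 * π t.1 t.2 := by
  obtain ⟨y, b⟩ := t
  rw [stepLaw, PMF.bind_apply, tsum_eq_single y, PMF.map_apply, tsum_eq_single b]
  · simp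
  · intro b' hb'
    simp [hb'.symm]
  · intro y' hy'
    simp [PMF.map_apply, hy'.symm]

/-! ### Occupation probabilities of the trajectory killed on leaving `H`. -/

section Trajectories

variable [MeasurableSpace X] [DiscreteMeasurableSpace X]
  [MeasurableSpace A] [DiscreteMeasurableSpace A]

instance (M : SafeMDP X A) (π : Policy X A) (x : X) : IsProbabilityMeasure (M.trajLaw π x) := by
  have := PMF.toMeasure.isProbabilityMeasure ((π x).map fun a => (x, a))
  unfold trajLaw
  infer_instance

/-- The event that the trajectory has stayed in `H` up to time `n`. -/
def stayUntil (M : SafeMDP X A) (n : ℕ) : Set (ℕ → X × A) := {ω | ∀ j ≤ n, (ω j).1 ∈ M.H}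

theorem measurableSet_coord_mem (n : ℕ) (T : Set (X × A)) :
    MeasurableSet {ω : ℕ → X × A | ω n ∈ T} :=
  measurable_pi_apply n (MeasurableSet.of_discrete (s := T))

/-- The Markov property of the trajectory law for events in the past that fix the present. -/
theorem trajLaw_inter_coord_succ (M : SafeMDP X A) (π : Policy X A) (x : X) (n : ℕ) (s : X × A)
    (T : Set (X × A)) :
    M.trajLaw π x (M.stayUntil n ∩ {ω | ω n = s} ∩ {ω | ω (n + 1) ∈ T}) =
      M.trajLaw π x (M.stayUntil n ∩ {ω | ω n = s}) * (M.stepLaw π s).toMeasure T := by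
  have := PMF.toMeasure.isProbabilityMeasure ((π x).map fun a => (x, a))
  let κ : (n : ℕ) → Kernel (Finset.Iic n → X × A) (X × A) := fun n => (M.stepKernel π).comap
      (fun h : (Finset.Iic n → X × A) => h ⟨n, Finset.mem_Iic.2 le_rfl⟩) (measurable_pi_apply _)
  have key := Kernel.map_frestrictLe_trajMeasure_compProd_eq_map_trajMeasure
    (X := fun _ => X × A) (μ₀ := ((π x).map fun a => (x, a)).toMeasure) (κ := κ) (a := n)
  change (M.trajLaw π x).map _ ⊗ₘ _ = (M.trajLaw π x).map _ at key
  let S : Set (Finset.Iic n → X × A) :=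
    {h | (∀ j, (h j).1 ∈ M.H) ∧ h ⟨n, Finset.mem_Iic.2 le_rfl⟩ = s}
  have hS : MeasurableSet S := MeasurableSet.of_discrete
  have hT : MeasurableSet T := MeasurableSet.of_discrete
  have hpre : Preorder.frestrictLe (π := fun _ => X × A) n ⁻¹' S
      = M.stayUntil n ∩ {ω | ω n = s} := by
    ext ω
    simp [S, stayUntil]
  have h1 := congrArg (fun μ => μ (S ×ˢ T)) key
  rw [Measure.compProd_apply_prod hS hT, Measure.map_apply (by fun_prop) (hS.prod hT),
    Measure.restrict_map (by fun_prop) hS, hpre] at h1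
  rw [Set.mk_preimage_prod, hpre] at h1
  refine h1.symm.trans ?_
  rw [← hpre, ← Measure.restrict_map (by fun_prop) hS,
    setLIntegral_congr_fun (g := fun _ => (M.stepLaw π s).toMeasure T) hS, setLIntegral_const,
    Measure.map_apply (by fun_prop) hS, mul_comm]
  -- The kernel sees only the last coordinate of the past, and `S` fixes it to `s`, so the integrand
  -- is constant on `S`.
  intro h hh
  simp only [κ, Kernel.comap_apply, hh.2]
  rfl

/-- The probability that the trajectory stays in `H` up to time `n` and is at `s` at time `n`. -/
noncomputable def occ (M : SafeMDP X A) (π : Policy X A) (x : X) (n : ℕ) (s : X × A) : ℝ :=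
  (M.trajLaw π x).real (M.stayUntil n ∩ {ω | ω n = s})

theorem occ_nonneg (M : SafeMDP X A) (π : Policy X A) (x : X) (n : ℕ) (s : X × A) :
    0 ≤ M.occ π x n s := measureReal_nonneg

theorem trajLaw_coord_zero (M : SafeMDP X A) (π : Policy X A) (x : X) (T : Set (X × A)) :
    M.trajLaw π x {ω | ω 0 ∈ T} = ((π x).map fun a => (x, a)).toMeasure T := by
  have := PMF.toMeasure.isProbabilityMeasure ((π x).map fun a => (x, a))
  have h : (M.trajLaw π x).map (Preorder.frestrictLe (π := fun _ => X × A) 0) =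
      ((π x).map fun a => (x, a)).toMeasure.map
        (MeasurableEquiv.piUnique fun _ : Finset.Iic 0 => X × A).symm := by
    rw [trajLaw, Kernel.trajMeasure, Measure.map_comp _ _ (by fun_prop),
      Kernel.traj_map_frestrictLe, Kernel.partialTraj_self, Measure.id_comp]
  have hT : MeasurableSet T := MeasurableSet.of_discrete
  let S : Set (Finset.Iic 0 → X × A) := {h | h ⟨0, Finset.mem_Iic.2 le_rfl⟩ ∈ T}
  have hS : MeasurableSet S := MeasurableSet.of_discrete
  have h1 := congrArg (fun μ => μ S) h
  rw [Measure.map_apply (by fun_prop) hS, Measure.map_apply (MeasurableEquiv.measurable _) hS] at h1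
  exact h1

theorem toMeasure_map_prodMk_singleton (q : PMF A) (x : X) (s : X × A) :
    (q.map fun a => (x, a)).toMeasure {s} = if s.1 = x then q s.2 else 0 := by
  obtain ⟨y, b⟩ := s
  rw [PMF.toMeasure_apply_singleton _ _ (MeasurableSet.of_discrete), PMF.map_apply,
    tsum_eq_single b]
  · simp
  · intro b' hb'
    simp [hb'.symm]

theorem occ_zero (M : SafeMDP X A) (π : Policy X A) {x : X} (hx : x ∈ M.H) (s : X × A) :
    M.occ π x 0 s = if s.1 = x then (π x s.2).toReal else 0 := by
  have : M.stayUntil 0 ∩ {ω | ω 0 = s} = {ω | ω 0 ∈ {t : X × A | t.1 ∈ M.H ∧ t = s}} := by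
    ext ω; simp [stayUntil]
  rw [occ, measureReal_def, this, trajLaw_coord_zero]
  by_cases hs : s.1 ∈ M.H
  · rw [show {t : X × A | t.1 ∈ M.H ∧ t = s} = {s} by ext; simp; rintro rfl; exact hs,
      toMeasure_map_prodMk_singleton]
    split_ifs <;> simp
  · rw [if_neg (by rintro rfl; exact hs hx),
      show {t : X × A | t.1 ∈ M.H ∧ t = s} = ∅ by
        ext t; simp only [Set.mem_ofPred_eq, Set.mem_empty_iff_false, iff_false]
        rintro ⟨h, rfl⟩; exact hs h]
    simp

theorem trajLaw_real_coord_succ (M : SafeMDP X A) (π : Policy X A) (x : X) (n : ℕ)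
    (T : Set (X × A)) :
    (M.trajLaw π x).real (M.stayUntil n ∩ {ω | ω (n + 1) ∈ T}) =
      ∑ s, M.occ π x n s * (M.stepLaw π s).toMeasure.real T := by
  have hm : ∀ s : X × A, MeasurableSet {ω : ℕ → X × A | ω n = s} := fun s =>
    measurableSet_coord_mem n {s}
  have h1 : M.trajLaw π x (M.stayUntil n ∩ {ω | ω (n + 1) ∈ T}) =
      ∑ s, M.trajLaw π x (M.stayUntil n ∩ {ω | ω n = s} ∩ {ω | ω (n + 1) ∈ T}) := by
    have := sum_measure_preimage_singleton (Finset.univ : Finset (X × A))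
      (μ := (M.trajLaw π x).restrict (M.stayUntil n ∩ {ω | ω (n + 1) ∈ T}))
      (f := fun ω : ℕ → X × A => ω n) (fun s _ => hm s)
    simp only [Finset.coe_univ, Set.preimage_univ, Measure.restrict_apply_univ] at this
    rw [← this]
    refine Finset.sum_congr rfl fun s _ => ?_
    refine (Measure.restrict_apply (hm s)).trans ?_
    congr 1
    ext ω
    simp only [Set.mem_inter_iff, Set.mem_ofPred_eq]
    tauto
  rw [measureReal_def, h1, ENNReal.toReal_sum fun s _ => measure_ne_top _ _]
  refine Finset.sum_congr rfl fun s _ => ?_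
  rw [trajLaw_inter_coord_succ, ENNReal.toReal_mul]
  rfl

theorem stepLaw_toMeasure_real (M : SafeMDP X A) (π : Policy X A) (s : X × A)
    (T : Finset (X × A)) :
    (M.stepLaw π s).toMeasure.real T =
      ∑ t ∈ T, (M.P s.1 s.2 t.1).toReal * (π t.1 t.2).toReal := by
  rw [measureReal_def, PMF.toMeasure_apply_finset, ENNReal.toReal_sum
    fun t _ => PMF.apply_ne_top _ _]
  simp [stepLaw_apply]

/-- Forward Kolmogorov equation of the chain killed outside `H`. -/
theorem occ_succ (M : SafeMDP X A) (π : Policy X A) (x : X) (n : ℕ) (t : X × A) :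
    M.occ π x (n + 1) t = if t.1 ∈ M.H then
      ∑ s, M.occ π x n s * ((M.P s.1 s.2 t.1).toReal * (π t.1 t.2).toReal) else 0 := by
  split_ifs with ht
  · have : M.stayUntil (n + 1) ∩ {ω | ω (n + 1) = t} =
        M.stayUntil n ∩ {ω | ω (n + 1) ∈ (({t} : Finset (X × A)) : Set (X × A))} := by
      ext ω
      simp only [stayUntil, Set.mem_inter_iff, Set.mem_ofPred_eq, Finset.coe_singleton,
        Set.mem_singleton_iff]
      refine ⟨fun h => ⟨fun j hj => h.1 j (by omega), h.2⟩, fun h => ⟨fun j hj => ?_, h.2⟩⟩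
      rcases Nat.le_succ_iff.1 hj with hj | rfl
      · exact h.1 j hj
      · rw [h.2]; exact ht
    rw [occ, this, trajLaw_real_coord_succ]
    simp only [stepLaw_toMeasure_real, Finset.sum_singleton]
  · have : M.stayUntil (n + 1) ∩ {ω | ω (n + 1) = t} = ∅ := by
      ext ω
      simp only [stayUntil, Set.mem_inter_iff, Set.mem_ofPred_eq, Set.mem_empty_iff_false, iff_false]
      rintro ⟨h, rfl⟩
      exact ht (h _ le_rfl)
    rw [occ, this, measureReal_empty]

/-- The probability of entering `U` from `H` at time `n + 1`. -/
theorem trajLaw_real_exit (M : SafeMDP X A) (π : Policy X A) (x : X) (n : ℕ) :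
    (M.trajLaw π x).real (M.stayUntil n ∩ {ω | (ω (n + 1)).1 ∈ M.U}) =
      ∑ s, M.occ π x n s * ∑ y ∈ M.U, (M.P s.1 s.2 y).toReal := by
  have : {ω : ℕ → X × A | (ω (n + 1)).1 ∈ M.U} =
      {ω | ω (n + 1) ∈ ((M.U ×ˢ Finset.univ : Finset (X × A)) : Set (X × A))} := by
    ext ω; simp
  rw [this, trajLaw_real_coord_succ]
  simp only [stepLaw_toMeasure_real, Finset.sum_product, ← Finset.mul_sum, sum_toReal_eq_one,
    mul_one]

/-! ### Finite-horizon hitting probabilities and the safety function. -/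

/-- The probability of reaching `U` from `x` within `n` steps, and without leaving `H` before. -/
noncomputable def hitProb (M : SafeMDP X A) (π : Policy X A) : ℕ → X → ℝ
  | 0, x => if x ∈ M.U then 1 else 0
  | n + 1, x => if x ∈ M.H then
      ∑ a, (π x a).toReal * ∑ y, (M.P x a y).toReal * hitProb M π n y
    else if x ∈ M.U then 1 else 0

theorem hitProb_of_mem_U (M : SafeMDP X A) (π : Policy X A) (n : ℕ) {x : X} (hx : x ∈ M.U) :
    M.hitProb π n x = 1 := by
  cases n <;> simp [hitProb, hx, mem_H_iff]

theorem hitProb_of_mem_E (M : SafeMDP X A) (π : Policy X A) (n : ℕ) {x : X} (hx : x ∈ M.E) :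
    M.hitProb π n x = 0 := by
  have : x ∉ M.U := fun h => Finset.disjoint_left.1 M.disjoint h hx
  cases n <;> simp [hitProb, hx, this, mem_H_iff]

theorem hitProb_succ (M : SafeMDP X A) (π : Policy X A) (n : ℕ) {x : X} (hx : x ∈ M.H) :
    M.hitProb π (n + 1) x =
      ∑ a, (π x a).toReal * ∑ y, (M.P x a y).toReal * M.hitProb π n y := by
  rw [hitProb, if_pos hx]

theorem hitProb_nonneg (M : SafeMDP X A) (π : Policy X A) (n : ℕ) (x : X) :
    0 ≤ M.hitProb π n x := by
  induction n generalizing x with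
  | zero => unfold hitProb; split_ifs <;> norm_num
  | succ n ih =>
    unfold hitProb
    split_ifs
    · exact Finset.sum_nonneg fun a _ => mul_nonneg ENNReal.toReal_nonneg
        (Finset.sum_nonneg fun y _ => mul_nonneg ENNReal.toReal_nonneg (ih y))
    · norm_num
    · norm_num

theorem hitProb_le_one (M : SafeMDP X A) (π : Policy X A) (n : ℕ) (x : X) :
    M.hitProb π n x ≤ 1 := by
  induction n generalizing x with
  | zero => unfold hitProb; split_ifs <;> norm_num
  | succ n ih =>
    unfold hitProb
    split_ifs
    · calc _ ≤ ∑ a, (π x a).toReal * ∑ y, (M.P x a y).toReal * 1 := by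
            gcongr with a _ y _
            exact ih y
        _ = 1 := by simp [sum_toReal_eq_one]
    · norm_num
    · norm_num

theorem hitProb_le_succ (M : SafeMDP X A) (π : Policy X A) (n : ℕ) (x : X) :
    M.hitProb π n x ≤ M.hitProb π (n + 1) x := by
  induction n generalizing x with
  | zero =>
    by_cases hx : x ∈ M.U
    · rw [hitProb_of_mem_U _ _ _ hx, hitProb_of_mem_U _ _ _ hx]
    · rw [hitProb, if_neg hx]
      exact hitProb_nonneg ..
  | succ n ih =>
    rw [hitProb, hitProb]
    split_ifs
    · gcongr with a _ y _
      exact ih y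
    · rfl
    · rfl

/-- Duality of the killed kernel: pushing `f` forward and pairing with `Q` is pairing `f` with `Q`
pulled back. Only an exchange of finite sums is involved. -/
theorem sum_forward_eq_sum_backward (M : SafeMDP X A) (π : Policy X A) (f Q : X × A → ℝ) :
    ∑ t, (if t.1 ∈ M.H then ∑ s, f s * ((M.P s.1 s.2 t.1).toReal * (π t.1 t.2).toReal) else 0) *
      Q t = ∑ s, f s * ∑ y, if y ∈ M.H then (M.P s.1 s.2 y).toReal *
        ∑ b, (π y b).toReal * Q (y, b) else 0 := by
  refine Eq.trans ?_ (Finset.sum_congr rfl fun s _ => (Finset.mul_sum _ _ (f s)).symm)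
  rw [Fintype.sum_prod_type]
  refine Eq.trans ?_ Finset.sum_comm
  refine Finset.sum_congr rfl fun y _ => ?_
  by_cases hy : y ∈ M.H
  · simp only [hy, if_true, Finset.mul_sum, Finset.sum_mul]
    rw [Finset.sum_comm]
    exact Finset.sum_congr rfl fun s _ => Finset.sum_congr rfl fun b _ => by ring
  · simp [hy]

/-- Decomposition by the time of entry: entries at times `1, …, n` are counted as exits, and the
mass still in `H` at time `n` has `m + 1` steps left. The induction moves one step from the backward
recursion to the forward one, hence the general `m`. -/
theorem sum_exit_add_sum_occ (M : SafeMDP X A) (π : Policy X A) {x : X} (hx : x ∈ M.H)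
    (n m : ℕ) :
    ∑ j ∈ Finset.range n, ∑ s, M.occ π x j s * ∑ y ∈ M.U, (M.P s.1 s.2 y).toReal +
      ∑ s, M.occ π x n s * ∑ y, (M.P s.1 s.2 y).toReal * M.hitProb π m y =
      M.hitProb π (n + m + 1) x := by
  induction n generalizing m with
  | zero =>
    rw [hitProb_succ _ _ _ hx]
    simp only [occ_zero _ _ hx, Finset.range_zero, Finset.sum_empty, zero_add,
      Fintype.sum_prod_type, ite_mul, zero_mul, Finset.sum_ite_irrel, Finset.sum_const_zero,
      Finset.sum_ite_eq', Finset.mem_univ, if_true]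
  | succ n ih =>
    rw [show n + 1 + m + 1 = n + (m + 1) + 1 by ring, ← ih, Finset.sum_range_succ, add_assoc]
    congr 1
    have hq : ∀ s : X × A, ∑ y, (M.P s.1 s.2 y).toReal * M.hitProb π (m + 1) y =
        ∑ y ∈ M.U, (M.P s.1 s.2 y).toReal + ∑ y, if y ∈ M.H then (M.P s.1 s.2 y).toReal *
          ∑ b, (π y b).toReal * ∑ z, (M.P y b z).toReal * M.hitProb π m z else 0 := by
      intro s
      rw [← Finset.univ_inter M.U, ← Finset.sum_ite_mem, ← Finset.sum_add_distrib]
      refine Finset.sum_congr rfl fun y _ => ?_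
      by_cases hU : y ∈ M.U
      · simp [hitProb_of_mem_U, hU, mem_H_iff]
      by_cases hE : y ∈ M.E
      · simp [hitProb_of_mem_E, hU, hE, mem_H_iff]
      have hH : y ∈ M.H := (M.mem_H_iff).2 ⟨hE, hU⟩
      simp [hU, hH, hitProb_succ]
    simp only [hq, mul_add, Finset.sum_add_distrib, occ_succ]
    congr 1
    exact sum_forward_eq_sum_backward M π (M.occ π x n)
      fun t => ∑ y, (M.P t.1 t.2 y).toReal * M.hitProb π m y

/-- Up to a null set, hitting `U` before `E` means entering `U` from `H` at some time `n + 1`. Each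
partial sum of these entry probabilities is at most a finite-horizon hitting probability, so no
limit has to be identified. -/
theorem safety_le (M : SafeMDP X A) (π : Policy X A) {x : X} (hx : x ∈ M.H) {p : ℝ}
    (h : ∀ n, M.hitProb π n x ≤ p) : M.safety π x ≤ p := by
  have hp : 0 ≤ p := (hitProb_nonneg M π 0 x).trans (h 0)
  rw [safety, measureReal_def]
  refine ENNReal.toReal_le_of_le_ofReal hp ?_
  have h0 : M.trajLaw π x {ω | (ω 0).1 ∉ M.H} = 0 := by
    refine (M.trajLaw_coord_zero π x {t | t.1 ∉ M.H}).trans ?_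
    rw [PMF.toMeasure_apply_eq_zero_iff _ MeasurableSet.of_discrete, Set.disjoint_left]
    intro t ht
    simp only [PMF.support_map, Set.mem_image] at ht
    obtain ⟨a, -, rfl⟩ := ht
    simpa using hx
  have hsub : {ω : ℕ → X × A | hitTime M.U ω < hitTime M.E ω} ⊆
      {ω | (ω 0).1 ∉ M.H} ∪ ⋃ n, (M.stayUntil n ∩ {ω | (ω (n + 1)).1 ∈ M.U}) := by
    intro ω hω
    rw [Set.mem_union, or_iff_not_imp_left]
    intro hH
    simp only [Set.mem_ofPred_eq, not_not] at hH
    have hex : ∃ j, (ω j).1 ∈ M.U := by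
      by_contra! hne
      have : hitTime M.U ω = ⊤ := by
        rw [hitTime, hittingAfter_eq_top_iff]
        exact fun j _ => hne j
      rw [Set.mem_ofPred_eq, this] at hω
      exact not_top_lt hω
    classical
    have hU : (Nat.find hex : WithTop ℕ) ≤ hitTime M.U ω := by
      by_contra! hlt
      obtain ⟨j, hj, hjU⟩ := hittingAfter_lt_iff.1 hlt
      exact Nat.find_min hex hj.2 hjU
    have hE : ∀ j ≤ Nat.find hex, (ω j).1 ∉ M.E := by
      intro j hj hjE
      have : hitTime M.E ω ≤ (j : WithTop ℕ) := hittingAfter_le_of_mem (Nat.zero_le j) hjE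
      exact absurd (hU.trans_lt (hω.trans_le this)) (by exact_mod_cast hj.not_gt)
    -- The first entry into `U` is not at time `0`, since the trajectory starts in `H`.
    obtain ⟨n, hn⟩ : ∃ n, Nat.find hex = n + 1 := by
      refine Nat.exists_eq_succ_of_ne_zero fun h0 => ?_
      have := Nat.find_spec hex
      rw [h0] at this
      exact ((M.mem_H_iff).1 hH).2 this
    refine Set.mem_iUnion.2 ⟨n, fun j hj => (M.mem_H_iff).2 ⟨hE j (by omega), ?_⟩, ?_⟩
    · exact Nat.find_min hex (by omega)
    · have := Nat.find_spec hex
      rwa [hn] at this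
  refine (measure_mono hsub).trans ((measure_union_le _ _).trans ?_)
  rw [h0, zero_add]
  refine (measure_iUnion_le _).trans (ENNReal.tsum_le_of_sum_range_le fun n => ?_)
  rw [← ENNReal.toReal_le_toReal (ENNReal.sum_ne_top.2 fun _ _ => measure_ne_top _ _)
    ENNReal.ofReal_ne_top, ENNReal.toReal_ofReal hp,
    ENNReal.toReal_sum fun _ _ => measure_ne_top _ _]
  have := M.sum_exit_add_sum_occ π hx n 0
  have h2 : 0 ≤ ∑ s, M.occ π x n s * ∑ y, (M.P s.1 s.2 y).toReal * M.hitProb π 0 y :=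
    Finset.sum_nonneg fun s _ => mul_nonneg (occ_nonneg ..) (Finset.sum_nonneg fun y _ =>
      mul_nonneg ENNReal.toReal_nonneg (hitProb_nonneg ..))
  simp only [← measureReal_def, trajLaw_real_exit]
  linarith [h (n + 0 + 1)]

theorem BoundedStopping.exists_occ_eq_zero {M : SafeMDP X A} (hτ : M.BoundedStopping)
    (π : Policy X A) : ∃ n, ∀ x s, M.occ π x n s = 0 := by
  obtain ⟨n, hn⟩ := hτ π
  refine ⟨n, fun x s => ?_⟩
  rw [occ, measureReal_def, measure_mono_null _ (hn x), ENNReal.toReal_zero]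
  rintro ω ⟨hω, -⟩ hle
  change hitTime (M.E ∪ M.U) ω ≤ _ at hle
  obtain ⟨j, hj, hjm⟩ := hittingAfter_le_iff.1 hle
  have := (M.mem_H_iff).1 (hω j hj.2)
  simp at hjm
  tauto

end Trajectories
end SafeMDP

/-! ### A feasible solution certifies safety. -/

namespace History
variable {X A : Type*} [Fintype X] [DecidableEq X] [Fintype A] [DecidableEq A]

/-- The factor `log (2|X||A|K/w)` of the confidence radius. -/
noncomputable def logTerm (X A : Type*) [Fintype X] [Fintype A] (K : ℕ) (w : ℝ) : ℝ :=
  Real.log (2 * Fintype.card X * Fintype.card A * K / w)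

theorem eps_eq (K : ℕ) (w : ℝ) (h : History X A) (x : X) (a : A) (y : X) :
    h.eps K w x a y = √(4 * h.Phat x a y * (1 - h.Phat x a y) * logTerm X A K w /
      max (h.visits x a : ℝ) 1) + 14 * logTerm X A K w / (3 * max ((h.visits x a : ℝ) - 1) 1) :=
  rfl

theorem eps_nonneg {K : ℕ} {w : ℝ} (hL : 0 ≤ logTerm X A K w) (h : History X A) (x : X) (a : A)
    (y : X) : 0 ≤ h.eps K w x a y := by
  rw [eps_eq]
  positivity

end History

namespace SafeMDP

variable {X A : Type*} [Fintype X] [DecidableEq X] [Fintype A] [DecidableEq A]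

/-- The division-free form survives a vanishing denominator: nonnegativity then makes every `β x a
z` zero, so the arbitrary choice of `π x` is harmless. -/
theorem IsExtracted.mul_sum {M : SafeMDP X A} {β : X → A → X → ℝ} {π : Policy X A}
    (hπ : M.IsExtracted β π) (hβ : ∀ x ∈ M.H, ∀ a y, 0 ≤ β x a y) {x : X} (hx : x ∈ M.H) (a : A) :
    (∑ a', ∑ z, β x a' z) * (π x a).toReal = ∑ z, β x a z := by
  by_cases h : ∑ a', ∑ z, β x a' z = 0
  · rw [h, zero_mul]
    exact ((Finset.sum_eq_zero_iff_of_nonneg fun a' _ =>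
      Finset.sum_nonneg fun z _ => hβ x hx a' z).1 h a (Finset.mem_univ a)).symm
  · rw [hπ x hx h, mul_div_cancel₀ _ h]

/-- One-sided accuracy of the estimated transition probabilities on `H`. -/
def IsAccurate (M : SafeMDP X A) (K : ℕ) (w : ℝ) (h : History X A) : Prop :=
  ∀ x ∈ M.H, ∀ a y, (M.P x a y).toReal - h.Phat x a y ≤ 2 * h.eps K w x a y

/-- The surplus of a `[0,1]`-valued function that is `1` on `U` and `0` on `E` along one step. -/
theorem IsFeasible.step_le {M : SafeMDP X A} {K : ℕ} {w p : ℝ} {x₀ : X} {h : History X A}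
    {β : X → A → X → ℝ} (hβ : M.IsFeasible K w p x₀ h β) (hacc : M.IsAccurate K w h)
    (heps : ∀ x a y, 0 ≤ h.eps K w x a y)
    {V : X → ℝ} (hV0 : ∀ y, 0 ≤ V y) (hV1 : ∀ y, V y ≤ 1) (hU : ∀ y ∈ M.U, V y = 1)
    (hE : ∀ y ∈ M.E, V y = 0) {x : X} (hx : x ∈ M.H) (a : A) :
    (∑ z, β x a z) * ∑ y, (M.P x a y).toReal * V y ≤
      ∑ y ∈ M.H, β x a y * V y +
        (∑ z, β x a z) * (h.kappaHat M x a + 3 * h.epsHat K w x a) := by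
  set b := ∑ z, β x a z with hb
  have hb0 : 0 ≤ b := Finset.sum_nonneg fun z _ => hβ.nonneg x hx a z
  have hdisj : ∀ y ∈ M.U, y ∉ M.E := fun y hy => Finset.disjoint_left.1 M.disjoint hy
  rw [History.kappaHat, History.epsHat, ← Finset.univ_inter M.H, ← Finset.univ_inter M.U,
    ← Finset.sum_ite_mem, ← Finset.sum_ite_mem, Finset.mul_sum, Finset.mul_sum,
    ← Finset.sum_add_distrib, Finset.mul_sum, ← Finset.sum_add_distrib]
  refine Finset.sum_le_sum fun y _ => ?_
  have h1 := hacc x hx a y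
  have h2 := hβ.lower x hx a y
  have h3 := heps x a y
  rw [← hb] at h2
  by_cases hyU : y ∈ M.U
  · have hyH : y ∉ M.H := fun hy => ((M.mem_H_iff).1 hy).2 hyU
    rw [if_neg hyH, if_pos hyU, hU y hyU, zero_add]
    exact mul_le_mul_of_nonneg_left (by linarith) hb0
  by_cases hyE : y ∈ M.E
  · have hyH : y ∉ M.H := fun hy => ((M.mem_H_iff).1 hy).1 hyE
    rw [if_neg hyH, if_neg hyU, hE y hyE]
    simp only [mul_zero, zero_add]
    positivity
  · rw [if_pos ((M.mem_H_iff).2 ⟨hyE, hyU⟩), if_neg hyU]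
    -- The constant `3`: accuracy replaces `P` by `P̂ + 2ε`, and the lower LP constraint replaces `b
    -- * P̂` by `β + b * ε`.
    have h4 : b * (M.P x a y).toReal ≤ β x a y + b * (3 * h.eps K w x a y) := by nlinarith
    calc b * ((M.P x a y).toReal * V y) = b * (M.P x a y).toReal * V y := by ring
      _ ≤ (β x a y + b * (3 * h.eps K w x a y)) * V y := mul_le_mul_of_nonneg_right h4 (hV0 y)
      _ ≤ β x a y * V y + b * (3 * h.eps K w x a y) * 1 := by
          rw [add_mul]; gcongr; exact hV1 y
      _ = _ := by ring

variable [MeasurableSpace X] [DiscreteMeasurableSpace X]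
  [MeasurableSpace A] [DiscreteMeasurableSpace A]

/-- A policy extracted from a feasible solution is safe if the estimates are accurate. -/
theorem IsFeasible.isPSafe {M : SafeMDP X A} {K : ℕ} {w p : ℝ} {x₀ : X} {h : History X A}
    {β : X → A → X → ℝ} {π : Policy X A} (hβ : M.IsFeasible K w p x₀ h β)
    (hπ : M.IsExtracted β π) (hx₀ : x₀ ∈ M.H) (hacc : M.IsAccurate K w h)
    (heps : ∀ x a y, 0 ≤ h.eps K w x a y) : M.IsPSafe p π x₀ := by
  refine M.safety_le π hx₀ fun n => ?_
  set V := M.hitProb π n with hV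
  -- Monotonicity in the horizon puts the same `V` on both sides, which lets the flow terms cancel
  -- below.
  have hpot : ∀ x ∈ M.H, (∑ a, ∑ z, β x a z) * V x ≤
      ∑ a, (∑ y ∈ M.H, β x a y * V y +
        (∑ z, β x a z) * (h.kappaHat M x a + 3 * h.epsHat K w x a)) := by
    intro x hx
    have hb0 : 0 ≤ ∑ a, ∑ z, β x a z :=
      Finset.sum_nonneg fun a _ => Finset.sum_nonneg fun z _ => hβ.nonneg x hx a z
    calc _ ≤ (∑ a, ∑ z, β x a z) * M.hitProb π (n + 1) x :=
          mul_le_mul_of_nonneg_left (M.hitProb_le_succ π n x) hb0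
      _ = ∑ a, (∑ z, β x a z) * ∑ y, (M.P x a y).toReal * V y := by
          rw [hitProb_succ _ _ _ hx, Finset.mul_sum]
          refine Finset.sum_congr rfl fun a _ => ?_
          rw [← mul_assoc, hπ.mul_sum hβ.nonneg hx]
      _ ≤ _ := Finset.sum_le_sum fun a _ => hβ.step_le hacc heps (M.hitProb_nonneg π n)
          (M.hitProb_le_one π n) (fun y hy => M.hitProb_of_mem_U π n hy)
          (fun y hy => M.hitProb_of_mem_E π n hy) hx a
  -- Flow balance tested against `V`.
  have hflow : V x₀ + ∑ y ∈ M.H, (∑ x ∈ M.H, ∑ a, β x a y) * V y =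
      ∑ y ∈ M.H, (∑ a, ∑ z, β y a z) * V y := by
    have : V x₀ = ∑ y ∈ M.H, (if y = x₀ then 1 else 0) * V y := by
      simp [hx₀]
    rw [this, ← Finset.sum_add_distrib]
    refine Finset.sum_congr rfl fun y hy => ?_
    rw [← add_mul]
    congr 1
    linarith [hβ.flow y hy]
  have hswap : ∑ y ∈ M.H, (∑ x ∈ M.H, ∑ a, β x a y) * V y =
      ∑ x ∈ M.H, ∑ a, ∑ y ∈ M.H, β x a y * V y := by
    simp only [Finset.sum_mul]
    rw [Finset.sum_comm]
    exact Finset.sum_congr rfl fun x _ => Finset.sum_comm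
  have hsum := Finset.sum_le_sum hpot
  simp only [Finset.sum_add_distrib] at hsum
  have hsafe := hβ.safe
  simp only [← Finset.sum_mul] at hsafe
  linarith

end SafeMDP

/-! ### Acyclicity of the possible transitions and visit counts. -/

namespace SafeMDP

variable {X A : Type*} [Fintype X] [DecidableEq X] [Fintype A] [DecidableEq A]

/-- There is a path of `n` possible transitions inside `H` that starts at the given state. -/
def HasPath (M : SafeMDP X A) : ℕ → X → Prop
  | 0, x => x ∈ M.H
  | n + 1, x => x ∈ M.H ∧ ∃ a y, M.P x a y ≠ 0 ∧ HasPath M n y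

theorem HasPath.mem_H {M : SafeMDP X A} {n : ℕ} {x : X} (h : M.HasPath n x) : x ∈ M.H := by
  cases n
  · exact h
  · exact h.1

/-- The rank of `x` is the least length for which no path starts at `x`; prepending a possible
transition to a path shows that it drops. -/
theorem exists_rank_of_bounded_paths {M : SafeMDP X A} {n : ℕ} (hn : ∀ x, ¬ M.HasPath n x) :
    ∃ ρ : X → ℕ, ∀ x ∈ M.H, ∀ a y, M.P x a y ≠ 0 → ρ y < ρ x := by
  classical
  have hex : ∀ x, ∃ m, ¬ M.HasPath m x := fun x => ⟨n, hn x⟩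
  refine ⟨fun x => Nat.find (hex x), fun x hx a y hP => ?_⟩
  obtain ⟨m, hm⟩ : ∃ m, Nat.find (hex x) = m + 1 :=
    Nat.exists_eq_succ_of_ne_zero fun h0 => by
      have := Nat.find_spec (hex x)
      rw [h0] at this
      exact this hx
  have hx' := Nat.find_spec (hex x)
  rw [hm] at hx'
  have hy : ¬ M.HasPath m y := fun h => hx' ⟨hx, a, y, hP, h⟩
  change Nat.find (hex y) < Nat.find (hex x)
  rw [hm]
  exact Nat.lt_succ_of_le (Nat.find_min' (hex y) hy)

section Trajectories

variable [MeasurableSpace X] [DiscreteMeasurableSpace X]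
  [MeasurableSpace A] [DiscreteMeasurableSpace A]

/-- A policy of full support follows every possible path with positive probability. Positivity for
all actions at once is what allows the next step of the path to use any action. -/
theorem exists_occ_pos_of_hasPath (M : SafeMDP X A) {π : Policy X A} (hπ : ∀ x a, π x a ≠ 0)
    (x : X) (n : ℕ) {j : ℕ} {z : X} (hz : M.HasPath n z) (hj : ∀ b, 0 < M.occ π x j (z, b)) :
    ∃ z', ∀ b, 0 < M.occ π x (j + n) (z', b) := by
  induction n generalizing j z with
  | zero => exact ⟨z, hj⟩
  | succ n ih =>
    obtain ⟨-, a, y, hP, hy⟩ := hz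
    rw [show j + (n + 1) = j + 1 + n by ring]
    refine ih hy fun b => ?_
    rw [occ_succ, if_pos hy.mem_H]
    refine Finset.sum_pos' (fun s _ => mul_nonneg (occ_nonneg ..) (by positivity))
      ⟨(z, a), Finset.mem_univ _, mul_pos (hj a) (mul_pos ?_ ?_)⟩
    · exact ENNReal.toReal_pos hP (PMF.apply_ne_top _ _)
    · exact ENNReal.toReal_pos (hπ _ _) (PMF.apply_ne_top _ _)

/-- The possible transitions inside `H` are acyclic. -/
theorem BoundedStopping.exists_rank [Nonempty A] {M : SafeMDP X A} (hτ : M.BoundedStopping) :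
    ∃ ρ : X → ℕ, ∀ x ∈ M.H, ∀ a y, M.P x a y ≠ 0 → ρ y < ρ x := by
  -- The stopping bound of this single policy controls all possible paths, because it charges every
  -- action.
  let π : Policy X A := fun _ => PMF.uniformOfFintype A
  have hπ : ∀ x a, π x a ≠ 0 := fun x a => by simp [π]
  obtain ⟨n, hn⟩ := hτ.exists_occ_eq_zero π
  refine exists_rank_of_bounded_paths (n := n) fun x hx => ?_
  obtain ⟨z, hz⟩ := M.exists_occ_pos_of_hasPath hπ x n (j := 0) hx fun b => by
    rw [occ_zero _ _ hx.mem_H, if_pos rfl]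
    exact ENNReal.toReal_pos (hπ x b) (PMF.apply_ne_top _ _)
  rw [zero_add] at hz
  exact (hz (Classical.arbitrary A)).ne' (hn x _)

end Trajectories

/-- Ranks strictly decrease along an episode, so no state recurs; the rank bound is carried to drive
the induction. -/
theorem rank_le_of_mem_episode {M : SafeMDP X A} {ρ : X → ℕ}
    (hρ : ∀ x ∈ M.H, ∀ a y, M.P x a y ≠ 0 → ρ y < ρ x) (π : Policy X A) (n : ℕ) (x : X)
    {e : Episode X A} (he : e ∈ (M.episodeLaw π n x).support) :
    (∀ s ∈ e, ρ s.1 ≤ ρ x) ∧ ∀ z, e.countP (fun s => s.1 = z) ≤ 1 := by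
  induction n generalizing x e with
  | zero =>
    rw [episodeLaw, PMF.support_pure, Set.mem_singleton_iff] at he
    simp [he]
  | succ n ih =>
    rw [episodeLaw] at he
    split_ifs at he with hx
    · simp only [PMF.mem_support_bind_iff, PMF.support_map, Set.mem_image] at he
      obtain ⟨a, -, y, hy, e', he', rfl⟩ := he
      obtain ⟨h1, h2⟩ := ih y he'
      have hlt := hρ x hx a y hy
      refine ⟨?_, fun z => ?_⟩
      · intro s hs
        rcases List.mem_cons.1 hs with rfl | hs
        · exact le_rfl
        · exact (h1 s hs).trans hlt.le
      · rw [List.countP_cons]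
        by_cases hz : x = z
        · have : e'.countP (fun s => s.1 = z) = 0 := by
            rw [List.countP_eq_zero]
            intro s hs
            have := h1 s hs
            simp only [decide_eq_true_eq, ← hz]
            rintro h
            rw [h] at this
            omega
          rw [this]
          split_ifs <;> simp
        · simpa [hz] using h2 z
    · rw [PMF.support_pure, Set.mem_singleton_iff] at he
      simp [he]

/-- In the first `k` episodes every state is visited at most `k` times. -/
theorem visits_take_le {M : SafeMDP X A} {ρ : X → ℕ}
    (hρ : ∀ x ∈ M.H, ∀ a y, M.P x a y ≠ 0 → ρ y < ρ x) (pol : History X A → Policy X A) (T : ℕ)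
    (x₀ : X) {K : ℕ} {h : History X A} (hh : h ∈ (M.algorithmLaw pol T x₀ K).support) (k : ℕ)
    (x : X) (a : A) : History.visits (h.take k) x a ≤ k := by
  have hep : ∀ e ∈ h, e.countP (fun s => s.1 = x ∧ s.2.1 = a) ≤ 1 := by
    induction K generalizing h with
    | zero =>
      rw [algorithmLaw, PMF.support_pure, Set.mem_singleton_iff] at hh
      simp [hh]
    | succ K ih =>
      simp only [algorithmLaw, PMF.mem_support_bind_iff, PMF.support_map, Set.mem_image] at hh
      obtain ⟨h', hh', e', he', rfl⟩ := hh
      intro e he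
      rcases List.mem_append.1 he with he | he
      · exact ih hh' e he
      · rw [List.mem_singleton.1 he]
        refine le_trans (List.countP_mono_left ?_)
          ((rank_le_of_mem_episode hρ _ _ _ he').2 x)
        intro s _ hs
        simp only [decide_eq_true_eq] at hs ⊢
        exact hs.1
  rw [History.visits, List.countP_flatten]
  refine (List.sum_le_card_nsmul _ 1 fun c hc => ?_).trans ?_
  · obtain ⟨e, he, rfl⟩ := List.mem_map.1 hc
    exact hep e (List.mem_of_mem_take he)
  · simp

end SafeMDP

/-! ### Expectations under `PMF` and Markov's inequality. -/

section PMFExpectation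

variable {α β : Type*}

theorem PMF.tsum_bind_mul (p : PMF α) (f : α → PMF β) (g : β → ENNReal) :
    ∑' b, p.bind f b * g b = ∑' a, p a * ∑' b, f a b * g b := by
  simp_rw [PMF.bind_apply, ← ENNReal.tsum_mul_right, ← ENNReal.tsum_mul_left, mul_assoc]
  exact ENNReal.tsum_comm

theorem PMF.tsum_pure_mul (a : α) (g : α → ENNReal) : ∑' b, PMF.pure a b * g b = g a := by
  rw [tsum_eq_single a fun b hb => by simp [PMF.pure_apply, hb], PMF.pure_apply_self, one_mul]

theorem PMF.tsum_map_mul (p : PMF α) (f : α → β) (g : β → ENNReal) :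
    ∑' b, p.map f b * g b = ∑' a, p a * g (f a) := by
  rw [← PMF.bind_pure_comp, PMF.tsum_bind_mul]
  simp

theorem PMF.tsum_mul_le (p : PMF α) {g : α → ENNReal} {c : ENNReal} (h : ∀ a, g a ≤ c) :
    ∑' a, p a * g a ≤ c := by
  calc _ ≤ ∑' a, p a * c := ENNReal.tsum_le_tsum fun a => mul_le_mul_right (h a) _
    _ = c := by rw [ENNReal.tsum_mul_right, p.tsum_coe, one_mul]

theorem PMF.mul_toOuterMeasure_le (p : PMF α) (g : α → ENNReal) (c : ENNReal) :
    c * p.toOuterMeasure {a | c ≤ g a} ≤ ∑' a, p a * g a := by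
  rw [PMF.toOuterMeasure_apply, ← ENNReal.tsum_mul_left]
  refine ENNReal.tsum_le_tsum fun a => ?_
  by_cases h : c ≤ g a
  · rw [Set.indicator_of_mem (by exact h), mul_comm]
    exact mul_le_mul_right h _
  · rw [Set.indicator_of_notMem (by exact h), mul_zero]
    exact zero_le

end PMFExpectation

/-! ### Bernstein's inequality with empirical variance. -/

section Bernoulli

/-- From `exp t ≤ 1 + t + t ^ 2` for `|t| ≤ 1`: the linear terms cancel because the variable is
centred, and the quadratic ones give the variance. -/
theorem bernoulli_mgf_le {q l : ℝ} (hq0 : 0 ≤ q) (hq1 : q ≤ 1) (hl0 : 0 ≤ l) (hl1 : l ≤ 1) :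
    q * Real.exp (l * (q - 1)) + (1 - q) * Real.exp (l * q) ≤ Real.exp (l ^ 2 * (q * (1 - q))) := by
  have bound : ∀ t : ℝ, |t| ≤ 1 → Real.exp t ≤ 1 + t + t ^ 2 := fun t ht => by
    linarith [(abs_le.1 (Real.abs_exp_sub_one_sub_id_le ht)).2]
  have h1 := bound (l * (q - 1)) (abs_le.2 ⟨by nlinarith, by nlinarith⟩)
  have h2 := bound (l * q) (abs_le.2 ⟨by nlinarith, by nlinarith⟩)
  calc _ ≤ q * (1 + l * (q - 1) + (l * (q - 1)) ^ 2) + (1 - q) * (1 + l * q + (l * q) ^ 2) :=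
        add_le_add (mul_le_mul_of_nonneg_left h1 hq0)
          (mul_le_mul_of_nonneg_left h2 (sub_nonneg.2 hq1))
    _ = l ^ 2 * (q * (1 - q)) + 1 := by ring
    _ ≤ _ := Real.add_one_le_exp _

/-- The optimal parameter in `[0,1]` of the Chernoff bound with variance `v` and exponent `u`. -/
noncomputable def chernoffParam (u v : ℝ) : ℝ := if v ≤ u then 1 else √(u / v)

theorem chernoffParam_nonneg (u v : ℝ) : 0 ≤ chernoffParam u v := by
  unfold chernoffParam
  split_ifs <;> positivity

theorem chernoffParam_le_one {u v : ℝ} (hu : 0 < u) : chernoffParam u v ≤ 1 := by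
  unfold chernoffParam
  split_ifs with h
  · exact le_rfl
  · push Not at h
    exact Real.sqrt_le_iff.2 ⟨zero_le_one, by
      rw [one_pow, div_le_one (hu.trans h)]; exact h.le⟩

/-- From a Chernoff bound with the true variance to a bound with the empirical variance. -/
theorem sub_le_of_chernoff {q r u : ℝ} (hq0 : 0 ≤ q) (hr0 : 0 ≤ r) (hr1 : r ≤ 1)
    (hu : 0 < u) (h : chernoffParam u (q * (1 - q)) * (q - r) -
      chernoffParam u (q * (1 - q)) ^ 2 * (q * (1 - q)) ≤ u) :
    q - r ≤ 2 * √(2 * (r * (1 - r)) * u) + 14 / 3 * u := by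
  set v := q * (1 - q) with hv
  have hs : 0 ≤ √(2 * (r * (1 - r)) * u) := Real.sqrt_nonneg _
  by_cases hd : q - r ≤ 0
  · linarith
  push Not at hd
  unfold chernoffParam at h
  split_ifs at h with hvu
  · linarith
  push Not at hvu
  have hv0 : 0 < v := hu.trans hvu
  have hl : 0 < √(u / v) := Real.sqrt_pos.2 (div_pos hu hv0)
  have hl2 : √(u / v) ^ 2 * v = u := by
    rw [Real.sq_sqrt (div_pos hu hv0).le, div_mul_cancel₀ _ hv0.ne']
  rw [hl2] at h
  have h2 : (q - r) ^ 2 ≤ 4 * (u * v) := by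
    have h3 : √(u / v) * (q - r) ≤ 2 * u := by linarith
    have h4 : (√(u / v) * (q - r)) ^ 2 ≤ (2 * u) ^ 2 :=
      pow_le_pow_left₀ (mul_pos hl hd).le h3 2
    rw [mul_pow, Real.sq_sqrt (div_pos hu hv0).le, div_mul_eq_mul_div, div_le_iff₀ hv0] at h4
    have : u * ((q - r) ^ 2) ≤ u * (4 * (u * v)) := by linarith
    exact le_of_mul_le_mul_left this hu
  -- True and empirical variance differ by at most the deviation itself, which makes the bound a
  -- quadratic inequality in `q - r`.
  have hvr : v ≤ r * (1 - r) + (q - r) := by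
    have : v = r * (1 - r) + (q - r) * (1 - q - r) := by rw [hv]; ring
    nlinarith
  have hr : 0 ≤ r * (1 - r) := mul_nonneg hr0 (by linarith)
  by_contra! hcon
  set s := √(2 * (r * (1 - r)) * u)
  have hs2 : s ^ 2 = 2 * (r * (1 - r)) * u := Real.sq_sqrt (by positivity)
  have h5 : (q - r) ^ 2 ≤ 2 * s ^ 2 + 4 * u * (q - r) := by nlinarith
  nlinarith

end Bernoulli

/-! ### The exponential supermartingale along the visits. -/

namespace SafeMDP

variable {X A : Type*} [Fintype X] [DecidableEq X] [Fintype A] [DecidableEq A]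

/-- The product of the weights `g` of the successor states over the first `n` visits to `(x,a)`. -/
noncomputable def score (x : X) (a : A) (g : X → ENNReal) (n : ℕ) (l : Episode X A) : ENNReal :=
  (((l.filter fun s => s.1 = x ∧ s.2.1 = a).take n).map fun s => g s.2.2).prod

/-- Truncated subtraction is intended: once `l` has used up the `n` visits, the second factor is
`1`. -/
theorem score_append (x : X) (a : A) (g : X → ENNReal) (n : ℕ) (l l' : Episode X A) :
    score x a g n (l ++ l') = score x a g n l *
      score x a g (n - l.countP fun s => s.1 = x ∧ s.2.1 = a) l' := by
  simp only [score, List.filter_append, List.take_append, List.map_append, List.prod_append,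
    List.countP_eq_length_filter]

/-- Whatever the policy, the successor at a visit to `(x,a)` has law `P x a` given the past, so each
counted factor has conditional mean at most `1`. -/
theorem tsum_episodeLaw_mul_score_le (M : SafeMDP X A) (π : Policy X A) (x : X) (a : A)
    {g : X → ENNReal} (hg : ∑' y, M.P x a y * g y ≤ 1) (N : ℕ) (x' : X) (n : ℕ) :
    ∑' e, M.episodeLaw π N x' e * score x a g n e ≤ 1 := by
  induction N generalizing x' n with
  | zero => rw [episodeLaw, PMF.tsum_pure_mul]; simp [score]
  | succ N ih =>
    rw [episodeLaw]
    split_ifs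
    · rw [PMF.tsum_bind_mul]
      refine PMF.tsum_mul_le _ fun a' => ?_
      rw [PMF.tsum_bind_mul]
      simp_rw [PMF.tsum_map_mul]
      by_cases h : x' = x ∧ a' = a
      · obtain ⟨rfl, rfl⟩ := h
        cases n with
        | zero => exact PMF.tsum_mul_le _ fun y => by simp [score]
        | succ n =>
          have : ∀ y e, score x' a' g (n + 1) ((x', a', y) :: e) = g y * score x' a' g n e := by
            simp [score]
          simp_rw [this, mul_left_comm _ (g _), ENNReal.tsum_mul_left]
          refine (ENNReal.tsum_le_tsum fun y => ?_).trans hg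
          calc _ ≤ M.P x' a' y * (g y * 1) := by gcongr; exact ih y n
            _ = _ := by rw [mul_one]
      · refine PMF.tsum_mul_le _ fun y => ?_
        have : ∀ e, score x a g n ((x', a', y) :: e) = score x a g n e := by
          simp [score, h]
        simp_rw [this]
        exact ih y n
    · rw [PMF.tsum_pure_mul]; simp [score]

/-- The episode bound is uniform in the policy and the remaining visits, so it applies conditionally
on the earlier episodes, on which both depend. -/
theorem tsum_algorithmLaw_mul_score_le (M : SafeMDP X A) (pol : History X A → Policy X A) (T : ℕ)
    (x₀ : X) (x : X) (a : A) {g : X → ENNReal} (hg : ∑' y, M.P x a y * g y ≤ 1) (k n : ℕ) :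
    ∑' h, M.algorithmLaw pol T x₀ k h * score x a g n h.flatten ≤ 1 := by
  induction k with
  | zero => rw [algorithmLaw, PMF.tsum_pure_mul]; simp [score]
  | succ k ih =>
    rw [algorithmLaw, PMF.tsum_bind_mul]
    refine (ENNReal.tsum_le_tsum fun h => ?_).trans ih
    gcongr
    rw [PMF.tsum_map_mul]
    simp only [List.flatten_append, List.flatten_singleton, score_append]
    simp_rw [mul_left_comm _ (score x a g n _), ENNReal.tsum_mul_left]
    calc _ ≤ score x a g n h.flatten * 1 := by
          gcongr
          exact M.tsum_episodeLaw_mul_score_le _ x a hg _ _ _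
      _ = _ := mul_one _

/-- The weight of a successor state in the exponential supermartingale for `P x a y`. -/
noncomputable def expWeight (M : SafeMDP X A) (x : X) (a : A) (y : X) (l : ℝ) (z : X) : ENNReal :=
  ENNReal.ofReal (Real.exp (l * ((M.P x a y).toReal - if z = y then 1 else 0) -
    l ^ 2 * ((M.P x a y).toReal * (1 - (M.P x a y).toReal))))

theorem toReal_le_one {B : Type*} (q : PMF B) (b : B) : (q b).toReal ≤ 1 := by
  simpa using ENNReal.toReal_mono ENNReal.one_ne_top (q.coe_le_one b)

theorem tsum_expWeight_le (M : SafeMDP X A) (x : X) (a : A) (y : X) {l : ℝ} (hl0 : 0 ≤ l)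
    (hl1 : l ≤ 1) : ∑' z, M.P x a z * M.expWeight x a y l z ≤ 1 := by
  set q := (M.P x a y).toReal with hq
  have h1 : ∀ z, M.P x a z * M.expWeight x a y l z = ENNReal.ofReal ((M.P x a z).toReal *
      Real.exp (l * (q - if z = y then 1 else 0) - l ^ 2 * (q * (1 - q)))) := by
    intro z
    rw [ENNReal.ofReal_mul ENNReal.toReal_nonneg, ENNReal.ofReal_toReal (PMF.apply_ne_top _ _)]
    rfl
  rw [tsum_fintype]
  simp only [h1]
  rw [← ENNReal.ofReal_sum_of_nonneg fun z _ => by positivity, ENNReal.ofReal_le_one]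
  have h2 : ∑ z ∈ Finset.univ.erase y, (M.P x a z).toReal = 1 - q := by
    have := sum_toReal_eq_one (M.P x a)
    rw [← Finset.add_sum_erase _ _ (Finset.mem_univ y)] at this
    linarith
  simp only [Real.exp_sub, mul_div_assoc', ← Finset.sum_div]
  rw [div_le_one (Real.exp_pos _), ← Finset.add_sum_erase _ _ (Finset.mem_univ y), if_pos rfl,
    Finset.sum_congr rfl fun z hz => by rw [if_neg (Finset.ne_of_mem_erase hz), sub_zero],
    ← Finset.sum_mul, h2]
  exact bernoulli_mgf_le ENNReal.toReal_nonneg (toReal_le_one _ _) hl0 hl1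

theorem score_expWeight_of_count_eq (M : SafeMDP X A) (x : X) (a : A) (y : X) (l : ℝ)
    (e : Episode X A) :
    score x a (M.expWeight x a y l) (e.countP fun s => s.1 = x ∧ s.2.1 = a) e =
      ENNReal.ofReal (Real.exp (l * ((e.countP fun s => s.1 = x ∧ s.2.1 = a) *
        (M.P x a y).toReal - e.count (x, a, y)) - (e.countP fun s => s.1 = x ∧ s.2.1 = a) *
          (l ^ 2 * ((M.P x a y).toReal * (1 - (M.P x a y).toReal))))) := by
  simp only [score, List.countP_eq_length_filter, List.take_length]
  induction e with
  | nil => simp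
  | cons s e ih =>
    obtain ⟨x', a', z⟩ := s
    by_cases h : x' = x ∧ a' = a
    · obtain ⟨rfl, rfl⟩ := h
      rw [List.filter_cons_of_pos (by simp), List.map_cons, List.prod_cons, ih, expWeight,
        ← ENNReal.ofReal_mul (Real.exp_nonneg _), ← Real.exp_add, List.length_cons,
        List.count_cons]
      congr 2
      by_cases hz : z = y
      · subst hz
        simp only [if_true, beq_self_eq_true]
        push_cast
        ring
      · have : ((x', a', z) == (x', a', y)) = false := by simp [hz]
        simp only [this, if_neg hz]
        push_cast
        ring
    · have h2 : ((x', a', z) == (x, a, y)) = false := by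
        simp only [beq_eq_false_iff_ne, ne_eq, Prod.mk.injEq]
        tauto
      rw [List.filter_cons_of_neg (by simpa using h), ih, List.count_cons]
      simp [h2]

theorem transitions_le_visits (h : History X A) (x : X) (a : A) (y : X) :
    h.transitions x a y ≤ h.visits x a := by
  refine List.countP_mono_left fun s _ hs => ?_
  have := eq_of_beq hs
  simp [this]

theorem log_two_le_logTerm [Nonempty X] [Nonempty A] {K : ℕ} (hK : 0 < K) {w : ℝ}
    (hw : w ∈ Set.Ioo (0 : ℝ) 1) : Real.log 2 ≤ History.logTerm X A K w := by
  refine Real.log_le_log (by norm_num) ?_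
  rw [le_div_iff₀ hw.1]
  have h1 : (1 : ℝ) ≤ Fintype.card X := by exact_mod_cast Fintype.card_pos
  have h2 : (1 : ℝ) ≤ Fintype.card A := by exact_mod_cast Fintype.card_pos
  have h3 : (1 : ℝ) ≤ K := by exact_mod_cast hK
  have h4 : (1 : ℝ) ≤ Fintype.card X * Fintype.card A * K :=
    one_le_mul_of_one_le_of_one_le (one_le_mul_of_one_le_of_one_le h1 h2) h3
  nlinarith [hw.2]

/-- The exponential supermartingale for `P x a y`, stopped after `n` visits to `(x,a)`, is large. -/
def deviationEvent (M : SafeMDP X A) (L : ℝ) (x : X) (a : A) (y : X) (n : ℕ) :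
    Set (History X A) :=
  {h | ENNReal.ofReal (Real.exp (2 * L)) ≤
    score x a (M.expWeight x a y (chernoffParam (2 * L / n)
      ((M.P x a y).toReal * (1 - (M.P x a y).toReal)))) n h.flatten}

theorem toOuterMeasure_deviationEvent_le (M : SafeMDP X A) (pol : History X A → Policy X A)
    (T : ℕ) (x₀ : X) (K : ℕ) {L : ℝ} (hL : 0 < L) (x : X) (a : A) (y : X) {n : ℕ} (hn : 0 < n) :
    (M.algorithmLaw pol T x₀ K).toOuterMeasure (M.deviationEvent L x a y n) ≤
      ENNReal.ofReal (Real.exp (-(2 * L))) := by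
  have hu : 0 < 2 * L / n := by positivity
  have h1 := (PMF.mul_toOuterMeasure_le (M.algorithmLaw pol T x₀ K) _
    (ENNReal.ofReal (Real.exp (2 * L)))).trans (M.tsum_algorithmLaw_mul_score_le pol T x₀ x a
    (M.tsum_expWeight_le x a y (chernoffParam_nonneg (2 * L / n)
      ((M.P x a y).toReal * (1 - (M.P x a y).toReal))) (chernoffParam_le_one hu)) K n)
  rw [Real.exp_neg, ENNReal.ofReal_inv_of_pos (Real.exp_pos _)]
  rw [ENNReal.le_inv_iff_mul_le, mul_comm]
  exact h1

/-- With `n` equal to the number of visits before the episode, the stopped score of the full history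
depends only on `h.take k`. Level `exp (2 * L)` means exponent `2 * L / n` per visit, which
reproduces the square root in `2 * ε` exactly. -/
theorem sub_Phat_le_of_notMem_deviationEvent (M : SafeMDP X A) {K : ℕ} {w : ℝ}
    (hL : 0 < History.logTerm X A K w) (h : History X A) (k : ℕ) (x : X) (a : A) (y : X)
    (hn : 0 < History.visits (h.take k) x a)
    (hh : h ∉ M.deviationEvent (History.logTerm X A K w) x a y (History.visits (h.take k) x a)) :
    (M.P x a y).toReal - History.Phat (h.take k) x a y ≤
      2 * History.eps K w (h.take k) x a y := by
  set L := History.logTerm X A K w with hLdef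
  set n := History.visits (h.take k) x a with hndef
  set q := (M.P x a y).toReal with hq
  set l := chernoffParam (2 * L / n) (q * (1 - q)) with hl
  have hn0 : (0 : ℝ) < n := by exact_mod_cast hn
  have hn1 : (1 : ℝ) ≤ n := by exact_mod_cast hn
  have hPhat : History.Phat (h.take k) x a y = (History.transitions (h.take k) x a y : ℝ) / n := by
    rw [History.Phat, ← hndef, max_eq_left hn1]
  set r := History.Phat (h.take k) x a y with hr
  have hr0 : 0 ≤ r := by rw [hPhat]; positivity
  have hr1 : r ≤ 1 := by
    rw [hPhat, div_le_one hn0]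
    exact_mod_cast transitions_le_visits _ x a y
  have hscore : score x a (M.expWeight x a y l) n h.flatten =
      ENNReal.ofReal (Real.exp (l * (n * q - History.transitions (h.take k) x a y) -
        n * (l ^ 2 * (q * (1 - q))))) := by
    conv_lhs => rw [← List.take_append_drop k h]
    rw [List.flatten_append, score_append]
    have h0 : n - (h.take k).flatten.countP (fun s => s.1 = x ∧ s.2.1 = a) = 0 := by
      rw [hndef, History.visits, Nat.sub_self]
    rw [h0, show score x a (M.expWeight x a y l) 0 (h.drop k).flatten = 1 by simp [score], mul_one]
    exact M.score_expWeight_of_count_eq x a y l (h.take k).flatten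
  rw [deviationEvent, Set.mem_ofPred_eq, hscore, not_le,
    ENNReal.ofReal_lt_ofReal_iff (Real.exp_pos _), Real.exp_lt_exp] at hh
  have htr : (History.transitions (h.take k) x a y : ℝ) = n * r := by
    rw [hPhat, mul_div_cancel₀ _ hn0.ne']
  rw [htr] at hh
  have hdev := sub_le_of_chernoff (q := q) ENNReal.toReal_nonneg hr0 hr1
    (u := 2 * L / n) (by positivity) (by
      rw [le_div_iff₀ hn0, ← hl]
      linarith)
  refine hdev.trans ?_
  rw [History.eps_eq, ← hndef, max_eq_left hn1, ← hLdef, ← hr, mul_add]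
  refine add_le_add (le_of_eq ?_) ?_
  · congr 2
    ring
  · rw [show 14 / 3 * (2 * L / n) = 2 * (14 * L / (3 * n)) by field_simp]
    gcongr
    exact max_le (by linarith) hn1

theorem sub_Phat_le_of_visits_eq_zero (M : SafeMDP X A) {K : ℕ} {w : ℝ}
    (hL : Real.log 2 ≤ History.logTerm X A K w) (h : History X A) (x : X) (a : A) (y : X)
    (hn : h.visits x a = 0) :
    (M.P x a y).toReal - h.Phat x a y ≤ 2 * h.eps K w x a y := by
  have ht : h.transitions x a y = 0 := Nat.le_zero.1 (hn ▸ transitions_le_visits h x a y)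
  rw [History.eps_eq, History.Phat, hn, ht]
  have h1 := toReal_le_one (M.P x a) y
  have h2 := Real.log_two_gt_d9
  -- Without visits `ε = 14 / 3 * L`, and `L ≥ log 2` makes `2 * ε` exceed `1`.
  norm_num
  linarith

end SafeMDP

/-! ### Union bound and conclusion. -/

namespace SafeMDP

variable {X A : Type*} [Fintype X] [DecidableEq X] [Fintype A] [DecidableEq A]

/-- Since `exp (-2L) = w² / (4|X|²|A|²K²)`, the left side is `w² / (4|A|K)`. -/
theorem union_bound_le [Nonempty X] [Nonempty A] {K : ℕ} (hK : 0 < K) {w : ℝ}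
    (hw : w ∈ Set.Ioo (0 : ℝ) 1) :
    (Fintype.card X * Fintype.card A * Fintype.card X * K : ℝ) *
      Real.exp (-(2 * History.logTerm X A K w)) ≤ 2 * w := by
  have h1 : (1 : ℝ) ≤ Fintype.card X := by exact_mod_cast Fintype.card_pos
  have h2 : (1 : ℝ) ≤ Fintype.card A := by exact_mod_cast Fintype.card_pos
  have h3 : (1 : ℝ) ≤ K := by exact_mod_cast hK
  have hw0 := hw.1
  have hexp : Real.exp (History.logTerm X A K w) =
      2 * Fintype.card X * Fintype.card A * K / w := Real.exp_log (by positivity)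
  rw [Real.exp_neg, two_mul (History.logTerm X A K w), Real.exp_add, hexp, ← div_eq_mul_inv,
    div_le_iff₀ (by positivity)]
  have h4 : (1 : ℝ) ≤ Fintype.card A * K := one_le_mul_of_one_le_of_one_le h2 h3
  have h5 : 1 ≤ 8 / w := by rw [le_div_iff₀ hw0]; linarith [hw.2]
  calc _ = (Fintype.card X * Fintype.card A * Fintype.card X * K : ℝ) * (1 * 1) := by ring
    _ ≤ (Fintype.card X * Fintype.card A * Fintype.card X * K : ℝ) *
        ((Fintype.card A * K) * (8 / w)) := by gcongr
    _ = _ := by field_simp; ring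

/-- With high probability the estimates are accurate before each of the `K` episodes. -/
theorem le_toOuterMeasure_isAccurate [Nonempty X] [Nonempty A] {M : SafeMDP X A} {ρ : X → ℕ}
    (hρ : ∀ x ∈ M.H, ∀ a y, M.P x a y ≠ 0 → ρ y < ρ x) (pol : History X A → Policy X A)
    (T : ℕ) (x₀ : X) {K : ℕ} (hK : 0 < K) {w : ℝ} (hw : w ∈ Set.Ioo (0 : ℝ) 1) :
    ENNReal.ofReal (1 - 2 * w) ≤ (M.algorithmLaw pol T x₀ K).toOuterMeasure
      {h | ∀ k < K, M.IsAccurate K w (h.take k)} := by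
  set μ := (M.algorithmLaw pol T x₀ K).toOuterMeasure with hμ
  set L := History.logTerm X A K w with hLdef
  have hL2 : Real.log 2 ≤ L := log_two_le_logTerm hK hw
  have hL : 0 < L := (Real.log_pos one_lt_two).trans_le hL2
  -- Zero visits need no probability, and fewer than `K` episodes precede each decision.
  let I : Finset ((X × A × X) × ℕ) := Finset.univ ×ˢ Finset.Ico 1 K
  let D : (X × A × X) × ℕ → Set (History X A) := fun i =>
    M.deviationEvent L i.1.1 i.1.2.1 i.1.2.2 i.2
  have hD : μ (⋃ i ∈ I, D i) ≤ ENNReal.ofReal (2 * w) := by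
    calc μ (⋃ i ∈ I, D i) ≤ ∑ i ∈ I, μ (D i) := measure_biUnion_finset_le I D
      _ ≤ ∑ i ∈ I, ENNReal.ofReal (Real.exp (-(2 * L))) := by
          refine Finset.sum_le_sum fun i hi => ?_
          exact M.toOuterMeasure_deviationEvent_le pol T x₀ K hL _ _ _
            (Finset.mem_Ico.1 (Finset.mem_product.1 hi).2).1
      _ = ENNReal.ofReal (I.card * Real.exp (-(2 * L))) := by
          rw [Finset.sum_const, nsmul_eq_mul, ENNReal.ofReal_mul (Nat.cast_nonneg _),
            ENNReal.ofReal_natCast]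
      _ ≤ ENNReal.ofReal (2 * w) := by
          refine ENNReal.ofReal_le_ofReal (le_trans ?_ (union_bound_le (X := X) (A := A) hK hw))
          gcongr
          have : I.card ≤ Fintype.card X * Fintype.card A * Fintype.card X * K := by
            simp only [I, Finset.card_product, Finset.card_univ, Fintype.card_prod, Nat.card_Ico]
            rw [mul_assoc (Fintype.card X) (Fintype.card A)]
            exact Nat.mul_le_mul_left _ (Nat.sub_le _ _)
          exact_mod_cast this
  -- The bound on the visits holds only for histories of positive probability, hence the support.
  have hcover : Set.univ ∩ (M.algorithmLaw pol T x₀ K).support ⊆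
      {h | ∀ k < K, M.IsAccurate K w (h.take k)} ∪ ⋃ i ∈ I, D i := by
    rintro h ⟨-, hh⟩
    rw [Set.mem_union, or_iff_not_imp_right]
    intro hnot k hk x _ a y
    rcases Nat.eq_zero_or_pos (History.visits (h.take k) x a) with h0 | hpos
    · exact M.sub_Phat_le_of_visits_eq_zero hL2 _ x a y h0
    · refine M.sub_Phat_le_of_notMem_deviationEvent hL h k x a y hpos fun hdev => hnot ?_
      refine Set.mem_biUnion (x := ((x, a, y), History.visits (h.take k) x a)) ?_ hdev
      exact Finset.mem_coe.2 (Finset.mem_product.2 ⟨Finset.mem_univ _, Finset.mem_Ico.2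
        ⟨hpos, (visits_take_le hρ pol T x₀ hh k x a).trans_lt hk⟩⟩)
  have h1 : (1 : ENNReal) ≤ μ {h | ∀ k < K, M.IsAccurate K w (h.take k)} +
      ENNReal.ofReal (2 * w) := by
    calc (1 : ENNReal) = μ Set.univ :=
          ((PMF.toOuterMeasure_apply_eq_one_iff _ _).2 (Set.subset_univ _)).symm
      _ ≤ _ := PMF.toOuterMeasure_mono _ hcover
      _ ≤ _ := measure_union_le _ _
      _ ≤ _ := by gcongr
  rw [ENNReal.ofReal_sub _ (by linarith [hw.1]), ENNReal.ofReal_one]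
  exact tsub_le_iff_right.2 h1

end SafeMDP

theorem theorem2 {X A : Type*} [Fintype X] [DecidableEq X] [Fintype A] [DecidableEq A]
    [MeasurableSpace X] [DiscreteMeasurableSpace X]
    [MeasurableSpace A] [DiscreteMeasurableSpace A]
    (M : SafeMDP X A) (hτ : M.BoundedStopping)
    (x₀ : X) (hx₀ : x₀ ∈ M.H)
    (p : ℝ) (hp : p ∈ Set.Ioo (0 : ℝ) 1) (w : ℝ) (hw : w ∈ Set.Ioo (0 : ℝ) 1)
    (K T : ℕ) (πS : Policy X A)
    (pol : History X A → Policy X A) (hpol : M.IsAlgorithmRule K w p x₀ πS pol) :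
    ENNReal.ofReal (1 - 2 * w) ≤
      (M.algorithmLaw pol T x₀ K).toOuterMeasure
        {h | ∀ k < K, M.LPFeasible K w p x₀ (h.take k) →
          M.IsPSafe p (pol (h.take k)) x₀} := by
  have : Nonempty X := ⟨x₀⟩
  have : Nonempty A := (πS x₀).support_nonempty.nonempty
  -- For `K = 0` the event is everything; otherwise `K ≥ 1` makes the logarithm positive.
  rcases Nat.eq_zero_or_pos K with rfl | hK
  · rw [(PMF.toOuterMeasure_apply_eq_one_iff _ _).2
      fun h _ k hk => absurd hk (Nat.not_lt_zero k), ENNReal.ofReal_le_one]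
    linarith [hw.1]
  obtain ⟨ρ, hρ⟩ := hτ.exists_rank
  refine (SafeMDP.le_toOuterMeasure_isAccurate hρ pol T x₀ hK hw).trans (measure_mono ?_)
  intro h hacc k hk hfeas
  obtain ⟨β, hβ, hext⟩ := (hpol (h.take k)).1 hfeas
  exact hβ.1.isPSafe hext hx₀ (hacc k hk) fun x a y => History.eps_nonneg
    ((Real.log_nonneg one_le_two).trans (SafeMDP.log_two_le_logTerm hK hw)) _ x a y
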